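/- **Theorem 1.** Let $K$ be a natural number, let $(S_1,\mathcal S_1),\dots,(S_K,\mathcal S_K)$ be measurable spaces with probability measures $\mu_1,\dots,\mu_K$, and let $\mu=\mu_1\times\dots\times\mu_K$ on $S=S_1\times\dots\times S_K$ with the product $\sigma$-algebra. Write $[K]=\{1,\dots,K\}$ and, for $A\subseteq[K]$, $S_A=\prod_{k\in A}S_k$, $\mu_A=\prod_{k\in A}\mu_k$, $A^c=[K]\setminus A$ and $|A|$ for the cardinality of $A$. Write $\mu(f)=\int f\,d\mu$. For $\varphi:S\to\mathbb R$ let $\mu_{A^c}(\varphi)$ be the function on $S_A$ obtained by integrating the arguments of $\varphi$ indexed by $A^c$ with respect to $\mu_{A^c}$ (so $\mu_\emptyset(\varphi)=\varphi$); similarly, for $B\subseteq A$ and $\psi:S_A\to\mathbb R$, $\mu_{A\setminus B}(\psi)$ is the function on $S_B$ obtained by integrating the arguments indexed by $A\setminus B$. Wherever such an integral does not exist, the function is given the value $0$. For i.i.d. samples $X^n=(X^n_1,\dots,X^n_K)$ with law $\mu$, set $$\mu^N_\times(\varphi)=\frac1{N^K}\sum_{(n_1,\dots,n_K)\in\{1,\dots,N\}^K}\varphi\big(X_1^{n_1},\dots,X_K^{n_K}\big).$$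 1. If $\varphi$ is $\mu$-integrable then, for every $N>0$, $\mu^N_\times(\varphi)$ is integrable and $\mathbb E[\mu^N_\times(\varphi)]=\mu(\varphi)$. 2. If $\varphi\in L^2_\mu$ then the following hold. (a) For every $A\subseteq[K]$, the integral defining $\mu_{A^c}(\varphi)(x)$ exists for $\mu_A$-almost every $x\in S_A$, and $\mu_{A^c}(\varphi)\in L^2_{\mu_A}$. (b) For every $N>0$, $\mu^N_\times(\varphi)$ is square integrable and $$\mathrm{Var}(\mu^N_\times(\varphi))=\sum_{\emptyset\ne A\subseteq[K]}\frac1{N^{|A|}}\sum_{B\subseteq A}(-1)^{|A|-|B|}\sigma^2_{A,B}(\mu_{A^c}(\varphi)),$$ where $\sigma^2_{A,B}(\psi):=\mu_B\big([\mu_{A\setminus B}(\psi)-\mu_A(\psi)]^2\big)$ for $\psi\in L^2_{\mu_A}$ and $B\subseteq A\subseteq[K]$. (c) $\lim_{N\to\infty}\mu^N_\times(\varphi)=\mu(\varphi)$ almost surely. (d) $N^{1/2}[\mu^N_\times(\varphi)-\mu(\varphi)]$ converges in distribution to $\mathcal N(0,\sigma^2_\times(\varphi))$ as $N\to\infty$,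 where $$\sigma^2_\times(\varphi):=\sum_{k=1}^K\sigma_k^2(\varphi),\qquad \sigma^2_k(\varphi):=\mu_k\big([\mu_{\{k\}^c}(\varphi)-\mu(\varphi)]^2\big).$$ If $\sigma^2_\times(\varphi)=0$, then $\mathcal N(0,0)$ is the point mass at $0$. -/

import Mathlib

open MeasureTheory ProbabilityTheory Filter Topology

namespace ProductForm

variable {K : ℕ} {S : Fin K → Type*} [∀ k, MeasurableSpace (S k)]

/-- The product measure `μ_A = ∏_{k ∈ A} μ_k` on `S_A = ∏_{k ∈ A} S_k`. -/
noncomputable def prodOn (μ : ∀ k, Measure (S k)) (A : Finset (Fin K)) :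
    Measure (∀ k : A, S k) :=
  Measure.pi fun k : A => μ k

/-- The point of `S` with coordinates `x` on `A` and `y` on the complement of `A`. -/
def glueCompl (A : Finset (Fin K)) (x : ∀ k : A, S k) (y : ∀ k : (Aᶜ : Finset (Fin K)), S k) :
    ∀ k, S k :=
  fun k => if h : k ∈ A then x ⟨k, h⟩ else y ⟨k, Finset.mem_compl.2 h⟩

/-- For `B ⊆ A`, the point of `S_A` with coordinates `x` on `B` and `y` on `A \ B`. -/
def glueSdiff (A B : Finset (Fin K)) (x : ∀ k : B, S k)
    (y : ∀ k : (A \ B : Finset (Fin K)), S k) : ∀ k : A, S k :=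
  fun k => if h : (k : Fin K) ∈ B then x ⟨k, h⟩ else y ⟨k, Finset.mem_sdiff.2 ⟨k.2, h⟩⟩

/-- `μ_{Aᶜ}(φ)`, a function on `S_A`: the coordinates outside `A` are integrated out. -/
noncomputable def margCompl (μ : ∀ k, Measure (S k)) (A : Finset (Fin K))
    (φ : (∀ k, S k) → ℝ) : (∀ k : A, S k) → ℝ :=
  fun x => ∫ y, φ (glueCompl A x y) ∂(prodOn μ Aᶜ)

/-- `μ_{A \ B}(ψ)` for `B ⊆ A` and `ψ` on `S_A`, a function on `S_B`. -/
noncomputable def margSdiff (μ : ∀ k, Measure (S k)) (A B : Finset (Fin K))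
    (ψ : (∀ k : A, S k) → ℝ) : (∀ k : B, S k) → ℝ :=
  fun x => ∫ y, ψ (glueSdiff A B x y) ∂(prodOn μ (A \ B))

/-- `σ²_{A,B}(ψ) = μ_B([μ_{A \ B}(ψ) - μ_A(ψ)]²)` for `B ⊆ A` and `ψ` on `S_A`. -/
noncomputable def sigmaSq (μ : ∀ k, Measure (S k)) (A B : Finset (Fin K))
    (ψ : (∀ k : A, S k) → ℝ) : ℝ :=
  ∫ x, (margSdiff μ A B ψ x - ∫ z, ψ z ∂(prodOn μ A)) ^ 2 ∂(prodOn μ B)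

/-- `σ²_k(φ) = μ_k([μ_{{k}ᶜ}(φ) - μ(φ)]²)`; here `S_k` and `μ_k` are identified with
`S_{{k}}` and `μ_{{k}}`. -/
noncomputable def asympVarAt (μ : ∀ k, Measure (S k)) (k : Fin K) (φ : (∀ k, S k) → ℝ) : ℝ :=
  ∫ x, (margCompl μ {k} φ x - ∫ z, φ z ∂(Measure.pi μ)) ^ 2 ∂(prodOn μ {k})

/-- The asymptotic variance `σ²_×(φ) = ∑_k σ²_k(φ)`. -/
noncomputable def asympVar (μ : ∀ k, Measure (S k)) (φ : (∀ k, S k) → ℝ) : ℝ :=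
  ∑ k, asympVarAt μ k φ

/-- The product-form estimator `N^{-K} ∑_{n ∈ [N]^K} φ(x_1^{n_1}, …, x_K^{n_K})` computed from
the `N` samples `x^1, …, x^N` in `S`. -/
noncomputable def prodEst {N : ℕ} (φ : (∀ k, S k) → ℝ) (x : Fin N → ∀ k, S k) : ℝ :=
  1 / (N : ℝ) ^ K * ∑ n : Fin K → Fin N, φ (fun k => x (n k) k)

/-- `(X i)` are independent samples drawn from `μ = μ_1 × ⋯ × μ_K`. -/
structure IsIIDSample {Ω ι : Type*} [MeasurableSpace Ω] (μ : ∀ k, Measure (S k))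
    (P : Measure Ω) (X : ι → Ω → ∀ k, S k) : Prop where
  indep : iIndepFun X P
  law : ∀ i, HasLaw (X i) (Measure.pi μ) P

end ProductForm

/-! The square of the estimator is a double sum over multi-indices `n`, `m`. The mean of a summand
depends only on the set `T` where they agree: given the shared coordinates the two factors are
independent copies, so the mean is q(T) = μ_T(μ_{Tᶜ}(φ)²) (`IsIIDSample.integral_mul`). Write q(T)
as the sum of its Möbius transform over A ⊆ T. A fraction N^{-|A|} of the pairs agree on A, so the
second moment is the sum over A of N^{-|A|} times the transform of q at A (`sum_sum_agree`). The
term A = ∅ is μ(φ)². For A ≠ ∅ the signs sum to zero, so each q(B) may be replaced by q(B) - μ(φ)² =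
σ²_{A,B}.

For the limits, write φ = μ(φ) + Hájek projection + remainder. On a sum of functions of one
coordinate each, the estimator is an ordinary i.i.d. sample mean (`prodEst_eq_hajek`), so the strong
law and the central limit theorem apply. The remainder has q = 0 on all sets of size at most 1, so
by the same second moment formula its estimator has second moment O(N⁻²)
(`integral_prodEst_hajekRem_sq_le`): summable, and negligible after scaling by √N. -/

namespace ProductForm

/-! ### Gluing blocks of coordinates preserves product measures -/

section Glue

variable {ι α β : Type*} [Fintype ι] [Fintype α] [Fintype β] {S : ι → Type*}
  [∀ i, MeasurableSpace (S i)] (μ : ∀ i, Measure (S i)) [∀ i, IsProbabilityMeasure (μ i)]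

/-- Each coordinate comes from exactly one of `a`, `b`, so a box pulls back to a product of boxes,
and boxes determine a product measure. -/
theorem measurePreserving_of_coord {a : α → ι} {b : β → ι}
    (h : Function.Bijective (Sum.elim a b))
    {g : (∀ i, S (a i)) × (∀ j, S (b j)) → ∀ i, S i}
    (ha : ∀ z i, g z (a i) = z.1 i) (hb : ∀ z j, g z (b j) = z.2 j) :
    MeasurePreserving g ((Measure.pi fun i => μ (a i)).prod (Measure.pi fun j => μ (b j)))
      (Measure.pi μ) := by
  have hg : Measurable g := by
    refine measurable_pi_iff.2 fun i => ?_
    obtain ⟨j | j, rfl⟩ := h.2 i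
    · simp only [Sum.elim_inl, ha]; fun_prop
    · simp only [Sum.elim_inr, hb]; fun_prop
  refine ⟨hg, (Measure.pi_eq fun s hs => ?_).symm⟩
  have hpre : g ⁻¹' (Set.univ.pi s) =
      (Set.univ.pi fun i => s (a i)) ×ˢ (Set.univ.pi fun j => s (b j)) := by
    ext z
    simp only [Set.mem_preimage, Set.mem_univ_pi, Set.mem_prod]
    refine ⟨fun H => ⟨fun i => ha z i ▸ H (a i), fun j => hb z j ▸ H (b j)⟩, fun H i => ?_⟩
    obtain ⟨j | j, rfl⟩ := h.2 i
    · exact (ha z j).symm ▸ H.1 j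
    · exact (hb z j).symm ▸ H.2 j
  rw [Measure.map_apply hg (MeasurableSet.univ_pi hs), hpre, Measure.prod_prod, Measure.pi_pi,
    Measure.pi_pi, ← (Equiv.ofBijective _ h).prod_comp, Fintype.prod_sum_type]
  rfl

theorem measurePreserving_pi_precomp {a : α → ι} (h : Function.Injective a) :
    MeasurePreserving (fun (x : ∀ i, S i) j => x (a j)) (Measure.pi μ)
      (Measure.pi fun j => μ (a j)) := by
  have hI := (iIndepFun_pi (μ := μ) (X := fun i (x : S i) => x)
    fun i => aemeasurable_id).precomp h
  exact (hI.hasLaw_pi fun j => (measurePreserving_eval μ (a j)).hasLaw).measurePreserving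
    (by fun_prop)

end Glue

/-- For `B ⊆ A`, the point of `S_{Bᶜ}` with coordinates `y` on `A \ B` and `z` on `Aᶜ`. -/
def glueBetween {K : ℕ} {S : Fin K → Type*} (A B : Finset (Fin K))
    (y : ∀ k : (A \ B : Finset (Fin K)), S k) (z : ∀ k : (Aᶜ : Finset (Fin K)), S k) :
    ∀ k : (Bᶜ : Finset (Fin K)), S k :=
  fun k => if h : (k : Fin K) ∈ A then y ⟨k, Finset.mem_sdiff.2 ⟨h, Finset.mem_compl.1 k.2⟩⟩
    else z ⟨k, Finset.mem_compl.2 h⟩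

theorem glueCompl_glueSdiff {K : ℕ} {S : Fin K → Type*} {A B : Finset (Fin K)} (hBA : B ⊆ A) (x : ∀ k : B, S k)
    (y : ∀ k : (A \ B : Finset (Fin K)), S k) (z : ∀ k : (Aᶜ : Finset (Fin K)), S k) :
    glueCompl A (glueSdiff A B x y) z = glueCompl B x (glueBetween A B y z) := by
  funext k
  by_cases hA : k ∈ A <;> by_cases hB : k ∈ B <;> simp [glueCompl, glueSdiff, glueBetween, hA, hB]
  exact absurd (hBA hB) hA

variable {K : ℕ} {S : Fin K → Type*} [∀ k, MeasurableSpace (S k)]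
  (μ : ∀ k, Measure (S k)) [∀ k, IsProbabilityMeasure (μ k)]

instance (A : Finset (Fin K)) : IsProbabilityMeasure (prodOn μ A) := by
  unfold prodOn; infer_instance

theorem measurePreserving_glueCompl (A : Finset (Fin K)) :
    MeasurePreserving (fun z : (∀ k : A, S k) × (∀ k : (Aᶜ : Finset (Fin K)), S k) =>
      glueCompl A z.1 z.2) ((prodOn μ A).prod (prodOn μ Aᶜ)) (Measure.pi μ) := by
  refine measurePreserving_of_coord μ (a := fun k : A => (k : Fin K))
    (b := fun k : (Aᶜ : Finset (Fin K)) => (k : Fin K)) ⟨?_, fun k => ?_⟩ ?_ ?_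
  · rw [Sum.elim_injective]
    refine ⟨Subtype.val_injective, Subtype.val_injective, fun i j h => ?_⟩
    exact Finset.mem_compl.1 j.2 (h ▸ i.2)
  · by_cases h : k ∈ A
    · exact ⟨.inl ⟨k, h⟩, rfl⟩
    · exact ⟨.inr ⟨k, Finset.mem_compl.2 h⟩, rfl⟩
  · intro z i; simp [glueCompl]
  · intro z j; simp [glueCompl, Finset.mem_compl.1 j.2]

theorem measurePreserving_glueBetween {A B : Finset (Fin K)} (hBA : B ⊆ A) :
    MeasurePreserving
      (fun z : (∀ k : (A \ B : Finset (Fin K)), S k) × (∀ k : (Aᶜ : Finset (Fin K)), S k) =>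
        glueBetween A B z.1 z.2) ((prodOn μ (A \ B)).prod (prodOn μ Aᶜ)) (prodOn μ Bᶜ) := by
  refine measurePreserving_of_coord (fun k : (Bᶜ : Finset (Fin K)) => μ k)
    (a := fun k : (A \ B : Finset (Fin K)) =>
      ⟨k, Finset.mem_compl.2 (Finset.mem_sdiff.1 k.2).2⟩)
    (b := fun k : (Aᶜ : Finset (Fin K)) =>
      ⟨k, Finset.mem_compl.2 fun h => Finset.mem_compl.1 k.2 (hBA h)⟩)
    ⟨?_, fun k => ?_⟩ ?_ ?_
  · rw [Sum.elim_injective]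
    refine ⟨fun i j h => ?_, fun i j h => ?_, fun i j h => ?_⟩
    · exact Subtype.ext (by simpa only [Subtype.mk.injEq] using h)
    · exact Subtype.ext (by simpa only [Subtype.mk.injEq] using h)
    · simp only [Subtype.mk.injEq] at h
      exact Finset.mem_compl.1 j.2 (h ▸ (Finset.mem_sdiff.1 i.2).1)
  · by_cases h : (k : Fin K) ∈ A
    · exact ⟨.inl ⟨k, Finset.mem_sdiff.2 ⟨h, Finset.mem_compl.1 k.2⟩⟩, rfl⟩
    · exact ⟨.inr ⟨k, Finset.mem_compl.2 h⟩, rfl⟩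
  · intro z i; simp [glueBetween, (Finset.mem_sdiff.1 i.2).1]
  · intro z j; simp [glueBetween, Finset.mem_compl.1 j.2]

theorem measurePreserving_restrict (A : Finset (Fin K)) :
    MeasurePreserving (fun (x : ∀ k, S k) (k : A) => x k) (Measure.pi μ) (prodOn μ A) :=
  measurePreserving_pi_precomp μ Subtype.val_injective

theorem integral_comp_of_measurePreserving {α β : Type*} [MeasurableSpace α] [MeasurableSpace β]
    {ν : Measure α} {ρ : Measure β} {g : α → β} (hg : MeasurePreserving g ν ρ) {f : β → ℝ}
    (hf : AEStronglyMeasurable f ρ) : ∫ x, f (g x) ∂ν = ∫ y, f y ∂ρ :=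
  hg.hasLaw.integral_comp hf

theorem sq_integral_le {α : Type*} [MeasurableSpace α] (ν : Measure α) [IsProbabilityMeasure ν]
    {f : α → ℝ} (hf : MemLp f 2 ν) : (∫ x, f x ∂ν) ^ 2 ≤ ∫ x, f x ^ 2 ∂ν := by
  have h := variance_eq_sub hf
  have h0 := variance_nonneg f ν
  simp only [Pi.pow_apply] at h
  linarith

/-! ### Partial averages -/

section Marginal

variable {φ : (∀ k, S k) → ℝ} {μ}

theorem integrable_glueCompl (hφ : Integrable φ (Measure.pi μ)) (A : Finset (Fin K)) :
    Integrable (fun z : (∀ k : A, S k) × (∀ k : (Aᶜ : Finset (Fin K)), S k) =>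
      φ (glueCompl A z.1 z.2)) ((prodOn μ A).prod (prodOn μ Aᶜ)) :=
  (measurePreserving_glueCompl μ A).integrable_comp_of_integrable hφ

theorem memLp_glueCompl (hφ : MemLp φ 2 (Measure.pi μ)) (A : Finset (Fin K)) :
    MemLp (fun z : (∀ k : A, S k) × (∀ k : (Aᶜ : Finset (Fin K)), S k) =>
      φ (glueCompl A z.1 z.2)) 2 ((prodOn μ A).prod (prodOn μ Aᶜ)) :=
  hφ.comp_measurePreserving (measurePreserving_glueCompl μ A)

theorem ae_integrable_glueCompl (hφ : Integrable φ (Measure.pi μ)) (A : Finset (Fin K)) :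
    ∀ᵐ x ∂(prodOn μ A), Integrable (fun y => φ (glueCompl A x y)) (prodOn μ Aᶜ) :=
  (integrable_glueCompl hφ A).prod_right_ae

theorem ae_sq_margCompl_le (hφ : MemLp φ 2 (Measure.pi μ)) (A : Finset (Fin K)) :
    ∀ᵐ x ∂(prodOn μ A),
      margCompl μ A φ x ^ 2 ≤ ∫ y, φ (glueCompl A x y) ^ 2 ∂(prodOn μ Aᶜ) := by
  have h := memLp_glueCompl hφ A
  filter_upwards [h.integrable_sq.prod_right_ae, h.aestronglyMeasurable.prodMk_left] with x hx hm
  exact sq_integral_le _ ((memLp_two_iff_integrable_sq hm).2 hx)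

/-- Jensen on almost every slice, then Fubini for φ². -/
theorem memLp_margCompl (hφ : MemLp φ 2 (Measure.pi μ)) (A : Finset (Fin K)) :
    MemLp (margCompl μ A φ) 2 (prodOn μ A) := by
  have h := memLp_glueCompl hφ A
  have hm : AEStronglyMeasurable (margCompl μ A φ) (prodOn μ A) :=
    h.aestronglyMeasurable.integral_prod_right'
  refine (memLp_two_iff_integrable_sq hm).2
    (h.integrable_sq.integral_prod_left.mono (hm.pow 2) ?_)
  filter_upwards [ae_sq_margCompl_le hφ A] with x hx
  rw [Real.norm_of_nonneg (sq_nonneg _)]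
  exact hx.trans (le_abs_self _)

theorem integral_margCompl (hφ : Integrable φ (Measure.pi μ)) (A : Finset (Fin K)) :
    ∫ x, margCompl μ A φ x ∂(prodOn μ A) = ∫ x, φ x ∂(Measure.pi μ) := by
  rw [← integral_comp_of_measurePreserving (measurePreserving_glueCompl μ A)
    hφ.aestronglyMeasurable, integral_prod _ (integrable_glueCompl hφ A)]
  rfl

/-- Tower property. It holds only almost everywhere because Fubini needs the slice at `x` to be
integrable. -/
theorem margSdiff_margCompl (hφ : Integrable φ (Measure.pi μ)) {A B : Finset (Fin K)}
    (hBA : B ⊆ A) :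
    margSdiff μ A B (margCompl μ A φ) =ᵐ[prodOn μ B] margCompl μ B φ := by
  filter_upwards [ae_integrable_glueCompl hφ B] with x hx
  have hg := measurePreserving_glueBetween μ hBA
  simp only [margSdiff, margCompl, glueCompl_glueSdiff hBA]
  rw [← integral_comp_of_measurePreserving hg hx.aestronglyMeasurable,
    integral_prod _ (by exact hg.integrable_comp_of_integrable hx)]

/-- The second moment of the partial average `μ_{Aᶜ}(φ)`. -/
noncomputable def margSq (μ : ∀ k, Measure (S k)) (φ : (∀ k, S k) → ℝ) (A : Finset (Fin K)) : ℝ :=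
  ∫ x, margCompl μ A φ x ^ 2 ∂(prodOn μ A)

/-- By the tower property the left side is the variance of `margCompl μ B φ`, whose mean is μ(φ);
hence `A` drops out. -/
theorem sigmaSq_margCompl (hφ : MemLp φ 2 (Measure.pi μ)) {A B : Finset (Fin K)} (hBA : B ⊆ A) :
    sigmaSq μ A B (margCompl μ A φ) = margSq μ φ B - (∫ x, φ x ∂(Measure.pi μ)) ^ 2 := by
  have hi := hφ.integrable one_le_two
  have hB := memLp_margCompl hφ B
  have h1 : sigmaSq μ A B (margCompl μ A φ) = Var[margCompl μ B φ; prodOn μ B] := by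
    rw [variance_eq_integral hB.aemeasurable, sigmaSq]
    refine integral_congr_ae ?_
    filter_upwards [margSdiff_margCompl hi hBA] with x hx
    rw [hx, integral_margCompl hi, integral_margCompl hi]
  rw [h1, variance_eq_sub hB, integral_margCompl hi]
  rfl

end Marginal

end ProductForm

/-! ### Joint laws of the summands -/

namespace ProductForm

/-- The coordinates in which two multi-indices agree. -/
def agree {K N : ℕ} (n m : Fin K → Fin N) : Finset (Fin K) := {k | n k = m k}

theorem glueCompl_agree {K N : ℕ} {S : Fin K → Type*} (x : Fin N → ∀ k, S k) (n m : Fin K → Fin N) :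
    glueCompl (agree n m) (fun k => x (n k) k) (fun k => x (m k) k) = fun k => x (m k) k := by
  funext k
  by_cases hk : k ∈ agree n m
  · have : n k = m k := by simpa [agree] using hk
    simp [glueCompl, hk, this]
  · simp [glueCompl, hk]

variable {K : ℕ} {S : Fin K → Type*} [∀ k, MeasurableSpace (S k)]
  {μ : ∀ k, Measure (S k)} [∀ k, IsProbabilityMeasure (μ k)]
  {Ω : Type*} [MeasurableSpace Ω] {P : Measure Ω} {N : ℕ} {X : Fin N → Ω → ∀ k, S k}

theorem measurePreserving_coords {γ : Type*} [Fintype γ] {σ : γ → Fin N × Fin K}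
    (hσ : Function.Injective σ) :
    MeasurePreserving (fun (x : Fin N → ∀ k, S k) c => x (σ c).1 (σ c).2)
      (Measure.pi fun _ => Measure.pi μ) (Measure.pi fun c => μ (σ c).2) := by
  have hI := iIndepFun_uncurry_infinitePi' (ι := Fin N) (X := fun _ k (x : S k) => x)
    (fun _ => μ) (fun _ _ => measurable_id)
  simp only [Measure.infinitePi_eq_pi] at hI
  refine ((hI.precomp hσ).hasLaw_pi fun c => ?_).measurePreserving (by fun_prop)
  exact (((measurePreserving_eval μ (σ c).2).comp
    (measurePreserving_eval (fun _ : Fin N => Measure.pi μ) (σ c).1))).hasLaw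

theorem IsIIDSample.hasLaw_coords (h : IsIIDSample μ P X) {γ : Type*} [Fintype γ]
    {σ : γ → Fin N × Fin K} (hσ : Function.Injective σ) :
    HasLaw (fun ω c => X (σ c).1 ω (σ c).2) (Measure.pi fun c => μ (σ c).2) P :=
  (measurePreserving_coords hσ).fun_comp_hasLaw (h.indep.hasLaw_pi h.law)

/-- Even if `n` repeats values, the entries `(n k, k)` are distinct, hence independent. Unbiasedness
follows from this. -/
theorem IsIIDSample.hasLaw_select (h : IsIIDSample μ P X) (n : Fin K → Fin N) :
    HasLaw (fun ω k => X (n k) ω k) (Measure.pi μ) P :=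
  h.hasLaw_coords (σ := fun k => (n k, k)) fun _ _ hij => congrArg Prod.snd hij

/-- The three blocks use pairwise distinct sample entries, since `n k ≠ m k` off the agreement set.
-/
theorem IsIIDSample.hasLaw_pair (h : IsIIDSample μ P X) (n m : Fin K → Fin N) :
    HasLaw (fun ω => ((fun k : agree n m => X (n k) ω k),
        ((fun k : ((agree n m)ᶜ : Finset (Fin K)) => X (n k) ω k),
          (fun k : ((agree n m)ᶜ : Finset (Fin K)) => X (m k) ω k))))
      ((prodOn μ (agree n m)).prod ((prodOn μ (agree n m)ᶜ).prod (prodOn μ (agree n m)ᶜ))) P := by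
  let C := ((agree n m)ᶜ : Finset (Fin K))
  let σ : agree n m ⊕ (C ⊕ C) → Fin N × Fin K :=
    Sum.elim (fun k => (n k, k)) (Sum.elim (fun k => (n k, k)) fun k => (m k, k))
  have hσ : Function.Injective σ := by
    simp only [σ]
    rw [Sum.elim_injective, Sum.elim_injective]
    refine ⟨fun i j hij => Subtype.ext (congrArg Prod.snd hij),
      ⟨fun i j hij => Subtype.ext (congrArg Prod.snd hij),
        fun i j hij => Subtype.ext (congrArg Prod.snd hij), fun i j hij => ?_⟩, fun i j hij => ?_⟩
    · have h2 : (i : Fin K) = j := congrArg Prod.snd hij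
      have h1 : n i = m j := congrArg Prod.fst hij
      exact Finset.mem_compl.1 i.2 (by simpa [agree, ← h2] using h1)
    · obtain j | j := j
      · have h2 : (i : Fin K) = j := congrArg Prod.snd hij
        exact Finset.mem_compl.1 j.2 (h2 ▸ i.2)
      · have h2 : (i : Fin K) = j := congrArg Prod.snd hij
        exact Finset.mem_compl.1 j.2 (h2 ▸ i.2)
  have h1 := measurePreserving_sumPiEquivProdPi fun c => μ (σ c).2
  have h2 := measurePreserving_sumPiEquivProdPi fun c : C ⊕ C => μ (σ (.inr c)).2
  exact (((MeasurePreserving.id _).prod h2).comp h1).fun_comp_hasLaw (h.hasLaw_coords hσ)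

/-- With the shared block fixed, the factors depend on independent blocks of the same law, so the
inner integral is the square of a partial average. -/
theorem IsIIDSample.integral_mul [IsProbabilityMeasure P] (h : IsIIDSample μ P X)
    {φ : (∀ k, S k) → ℝ}
    (hφ : MemLp φ 2 (Measure.pi μ)) (n m : Fin K → Fin N) :
    ∫ ω, φ (fun k => X (n k) ω k) * φ (fun k => X (m k) ω k) ∂P = margSq μ φ (agree n m) := by
  set T := agree n m with hT
  let ν := (prodOn μ T).prod ((prodOn μ Tᶜ).prod (prodOn μ Tᶜ))
  let f : (∀ k : T, S k) × (∀ k : (Tᶜ : Finset (Fin K)), S k) → ℝ :=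
    fun z => φ (glueCompl T z.1 z.2)
  have hf : MemLp f 2 ((prodOn μ T).prod (prodOn μ Tᶜ)) := memLp_glueCompl hφ T
  have h1 : MemLp (fun z : (∀ k : T, S k) × ((∀ k : (Tᶜ : Finset (Fin K)), S k) ×
      (∀ k : (Tᶜ : Finset (Fin K)), S k)) => f (z.1, z.2.1)) 2 ν :=
    hf.comp_measurePreserving ((MeasurePreserving.id _).prod measurePreserving_fst)
  have h2 : MemLp (fun z : (∀ k : T, S k) × ((∀ k : (Tᶜ : Finset (Fin K)), S k) ×
      (∀ k : (Tᶜ : Finset (Fin K)), S k)) => f (z.1, z.2.2)) 2 ν :=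
    hf.comp_measurePreserving ((MeasurePreserving.id _).prod measurePreserving_snd)
  have hint := h1.integrable_mul h2
  have key := (h.hasLaw_pair n m).integral_comp hint.aestronglyMeasurable
  have e1 : ∀ ω, φ (fun k => X (n k) ω k) =
      f ((fun k : T => X (n k) ω k), fun k => X (n k) ω k) := by
    intro ω
    simp only [f]
    congr 1
    funext k
    simp [glueCompl]
  have e2 : ∀ ω, φ (fun k => X (m k) ω k) =
      f ((fun k : T => X (n k) ω k), fun k => X (m k) ω k) := by
    intro ω
    simp only [f]
    rw [hT, glueCompl_agree (fun i => X i ω)]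
  simp only [e1, e2]
  refine (key.trans (integral_prod _ hint)).trans ?_
  refine integral_congr_ae (.of_forall fun x => ?_)
  simp only [Pi.mul_apply]
  rw [integral_prod_mul (fun y => f (x, y)) fun y => f (x, y), ← sq]
  rfl

variable {φ : (∀ k, S k) → ℝ}

theorem IsIIDSample.memLp_select (h : IsIIDSample μ P X) {p : ENNReal}
    (hφ : MemLp φ p (Measure.pi μ)) (n : Fin K → Fin N) :
    MemLp (fun ω => φ (fun k => X (n k) ω k)) p P := by
  have hl := h.hasLaw_select n
  rw [← hl.map_eq] at hφ
  exact hφ.comp_of_map hl.aemeasurable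

theorem IsIIDSample.memLp_prodEst (h : IsIIDSample μ P X) {p : ENNReal}
    (hφ : MemLp φ p (Measure.pi μ)) :
    MemLp (fun ω => prodEst φ (fun i => X i ω)) p P := by
  unfold prodEst
  exact (memLp_finsetSum _ fun n _ => h.memLp_select hφ n).const_mul _

theorem IsIIDSample.integral_prodEst (h : IsIIDSample μ P X) (hN : 0 < N)
    (hφ : Integrable φ (Measure.pi μ)) :
    ∫ ω, prodEst φ (fun i => X i ω) ∂P = ∫ x, φ x ∂(Measure.pi μ) := by
  have hi : ∀ n : Fin K → Fin N, ∫ ω, φ (fun k => X (n k) ω k) ∂P = ∫ x, φ x ∂(Measure.pi μ) :=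
    fun n => (h.hasLaw_select n).integral_comp hφ.aestronglyMeasurable
  unfold prodEst
  rw [integral_const_mul, integral_finsetSum]
  · have : (N : ℝ) ≠ 0 := by positivity
    simp [hi]
    field_simp
  · exact fun n _ => memLp_one_iff_integrable.1 (h.memLp_select (memLp_one_iff_integrable.2 hφ) n)

theorem IsIIDSample.integral_prodEst_sq_eq_sum [IsProbabilityMeasure P] (h : IsIIDSample μ P X)
    (hφ : MemLp φ 2 (Measure.pi μ)) :
    ∫ ω, prodEst φ (fun i => X i ω) ^ 2 ∂P =
      1 / ((N : ℝ) ^ K) ^ 2 * ∑ n : Fin K → Fin N, ∑ m : Fin K → Fin N,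
        margSq μ φ (agree n m) := by
  have e : ∀ ω, prodEst φ (fun i => X i ω) ^ 2 = 1 / ((N : ℝ) ^ K) ^ 2 *
      ∑ n : Fin K → Fin N, ∑ m : Fin K → Fin N,
        φ (fun k => X (n k) ω k) * φ (fun k => X (m k) ω k) := by
    intro ω
    rw [prodEst, mul_pow, ← Finset.sum_mul_sum, ← sq]
    simp
  have hi : ∀ n m : Fin K → Fin N,
      Integrable (fun ω => φ (fun k => X (n k) ω k) * φ (fun k => X (m k) ω k)) P :=
    fun n m => (h.memLp_select hφ n).integrable_mul (h.memLp_select hφ m)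
  simp only [e]
  rw [integral_const_mul, integral_finsetSum _ fun n _ => integrable_finsetSum _ fun m _ => hi n m]
  congr 1
  refine Finset.sum_congr rfl fun n _ => ?_
  rw [integral_finsetSum _ fun m _ => hi n m]
  exact Finset.sum_congr rfl fun m _ => h.integral_mul hφ n m

end ProductForm

/-! ### Möbius inversion and the variance formula -/

namespace ProductForm

section Combinatorics

/-- The Möbius transform of a function on finite sets. -/
noncomputable def moebius {α : Type*} (q : Finset α → ℝ) (A : Finset α) : ℝ :=
  ∑ B ∈ A.powerset, (-1 : ℝ) ^ (A.card - B.card) * q B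

/-- Writing A = B ∪ C with C ⊆ T \ B gives the alternating sum over a full powerset. -/
theorem sum_Icc_neg_one_pow {α : Type*} [DecidableEq α] {B T : Finset α} (h : B ⊆ T) :
    ∑ A ∈ Finset.Icc B T, (-1 : ℝ) ^ (A.card - B.card) = if B = T then 1 else 0 := by
  rw [Finset.Icc_eq_image_powerset h, Finset.sum_image]
  · have : ∀ C ∈ (T \ B).powerset, (-1 : ℝ) ^ ((B ∪ C).card - B.card) = (-1) ^ C.card := by
      intro C hC
      rw [Finset.card_union_of_disjoint, Nat.add_sub_cancel_left]
      exact Finset.disjoint_sdiff.mono_right (Finset.mem_powerset.1 hC)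
    rw [Finset.sum_congr rfl this]
    have h2 := congrArg (Int.cast : ℤ → ℝ) (Finset.sum_powerset_neg_one_pow_card (x := T \ B))
    push_cast at h2
    rw [h2]
    have : T \ B = ∅ ↔ B = T := by
      rw [Finset.sdiff_eq_empty_iff_subset]
      exact ⟨fun h' => h.antisymm h', fun h' => h'.ge⟩
    simp [this]
  · intro C hC D hD hCD
    have hC := Finset.mem_powerset.1 hC
    have hD := Finset.mem_powerset.1 hD
    have e : ∀ E ⊆ T \ B, (B ∪ E) \ B = E := fun E hE => by
      rw [Finset.union_sdiff_left]
      exact Finset.sdiff_eq_self_of_disjoint (Finset.disjoint_sdiff.symm.mono_left hE)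
    rw [← e C hC, ← e D hD]
    exact congrArg (· \ B) hCD

theorem sum_powerset_moebius {α : Type*} (q : Finset α → ℝ) (T : Finset α) :
    ∑ A ∈ T.powerset, moebius q A = q T := by
  classical
  unfold moebius
  rw [Finset.sum_comm' (t' := T.powerset) (s' := fun B => Finset.Icc B T)]
  · rw [Finset.sum_congr rfl fun B hB => by
      rw [← Finset.sum_mul, sum_Icc_neg_one_pow (Finset.mem_powerset.1 hB)]]
    simp
  · intro A B
    simp only [Finset.mem_powerset, Finset.mem_Icc]
    exact ⟨fun h => ⟨⟨h.2, h.1⟩, h.2.trans h.1⟩, fun h => ⟨h.1.2, h.1.1⟩⟩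

/-- `m` is forced on `A` and free elsewhere. The product form avoids the exponent K - |A|. -/
theorem card_subset_agree {K N : ℕ} (A : Finset (Fin K)) (n : Fin K → Fin N) :
    (Finset.univ.filter fun m : Fin K → Fin N => A ⊆ agree n m).card * N ^ A.card = N ^ K := by
  have h : (Finset.univ.filter fun m : Fin K → Fin N => A ⊆ agree n m) =
      Fintype.piFinset fun k => if k ∈ A then {n k} else Finset.univ := by
    ext m
    simp only [Finset.mem_filter, Finset.mem_univ, true_and, Fintype.mem_piFinset,
      Finset.subset_iff, agree]
    refine forall_congr' fun k => ?_
    by_cases hk : k ∈ A <;> simp [hk, eq_comm]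
  have h2 : ∀ k, (if k ∈ A then ({n k} : Finset (Fin N)) else Finset.univ).card =
      if k ∈ A then 1 else N := fun k => by split_ifs <;> simp
  rw [h, Fintype.card_piFinset, Finset.prod_congr rfl fun k _ => h2 k, Finset.prod_ite]
  simp only [Finset.prod_const, one_pow, one_mul, Finset.filter_not, Finset.filter_univ_mem,
    ← Finset.compl_eq_univ_sdiff]
  rw [← pow_add, Finset.card_compl_add_card, Fintype.card_fin]

theorem sum_sum_agree {K N : ℕ} (hN : 0 < N) (q : Finset (Fin K) → ℝ) :
    1 / ((N : ℝ) ^ K) ^ 2 * ∑ n : Fin K → Fin N, ∑ m : Fin K → Fin N, q (agree n m) =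
      ∑ A : Finset (Fin K), 1 / (N : ℝ) ^ A.card * moebius q A := by
  have hN' : (N : ℝ) ≠ 0 := by positivity
  have h1 : ∀ n m : Fin K → Fin N, q (agree n m) =
      ∑ A : Finset (Fin K), if A ⊆ agree n m then moebius q A else 0 := by
    intro n m
    rw [← Finset.sum_filter, ← sum_powerset_moebius q]
    exact Finset.sum_congr (by ext; simp) fun _ _ => rfl
  have h2 : ∀ (A : Finset (Fin K)) (n : Fin K → Fin N),
      (∑ m : Fin K → Fin N, if A ⊆ agree n m then moebius q A else 0) =
        (N : ℝ) ^ K / (N : ℝ) ^ A.card * moebius q A := by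
    intro A n
    have := congrArg (Nat.cast : ℕ → ℝ) (card_subset_agree A n)
    push_cast at this
    rw [← Finset.sum_filter, Finset.sum_const, nsmul_eq_mul, ← this]
    field_simp
  have h3 : ∑ n : Fin K → Fin N, ∑ m : Fin K → Fin N, q (agree n m) =
      ∑ A : Finset (Fin K), (N : ℝ) ^ K * ((N : ℝ) ^ K / (N : ℝ) ^ A.card * moebius q A) := by
    simp only [h1]
    rw [Finset.sum_congr rfl fun n _ => Finset.sum_comm, Finset.sum_comm]
    refine Finset.sum_congr rfl fun A _ => ?_
    rw [Finset.sum_congr rfl fun n _ => h2 A n]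
    simp
  rw [h3, Finset.mul_sum]
  refine Finset.sum_congr rfl fun A _ => ?_
  field_simp

end Combinatorics

variable {K : ℕ} {S : Fin K → Type*} [∀ k, MeasurableSpace (S k)]
  {μ : ∀ k, Measure (S k)} [∀ k, IsProbabilityMeasure (μ k)]
  {Ω : Type*} [MeasurableSpace Ω] {P : Measure Ω} [IsProbabilityMeasure P] {N : ℕ}
  {X : Fin N → Ω → ∀ k, S k} {φ : (∀ k, S k) → ℝ}

theorem IsIIDSample.integral_prodEst_sq (h : IsIIDSample μ P X) (hN : 0 < N)
    (hφ : MemLp φ 2 (Measure.pi μ)) :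
    ∫ ω, prodEst φ (fun i => X i ω) ^ 2 ∂P =
      ∑ A : Finset (Fin K), 1 / (N : ℝ) ^ A.card * moebius (margSq μ φ) A := by
  rw [h.integral_prodEst_sq_eq_sum hφ, sum_sum_agree hN]

theorem margCompl_empty (hφ : Integrable φ (Measure.pi μ)) (x : ∀ k : (∅ : Finset (Fin K)), S k) :
    margCompl μ ∅ φ x = ∫ z, φ z ∂(Measure.pi μ) := by
  rw [← integral_margCompl hφ ∅,
    integral_congr_ae (.of_forall fun y => congrArg _ (Subsingleton.elim y x))]
  simp

theorem margSq_empty (hφ : Integrable φ (Measure.pi μ)) :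
    margSq μ φ ∅ = (∫ z, φ z ∂(Measure.pi μ)) ^ 2 := by
  simp [margSq, margCompl_empty hφ]

theorem moebius_margSq_eq_sigmaSq (hφ : MemLp φ 2 (Measure.pi μ)) {A : Finset (Fin K)}
    (hA : A.Nonempty) :
    moebius (margSq μ φ) A =
      ∑ B ∈ A.powerset, (-1 : ℝ) ^ (A.card - B.card) * sigmaSq μ A B (margCompl μ A φ) := by
  have h0 : ∑ B ∈ A.powerset, (-1 : ℝ) ^ (A.card - B.card) = 0 := by
    have h1 := congrArg (Int.cast : ℤ → ℝ) (Finset.sum_powerset_neg_one_pow_card_of_nonempty hA)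
    push_cast at h1
    -- Since |B| ≤ |A|, the exponents |A| - |B| and |A| + |B| have the same parity.
    rw [← mul_zero ((-1 : ℝ) ^ A.card), ← h1, Finset.mul_sum]
    refine Finset.sum_congr rfl fun B hB => ?_
    have hc := Finset.card_le_card (Finset.mem_powerset.1 hB)
    rw [← pow_add, neg_one_pow_congr]
    grind
  rw [Finset.sum_congr rfl fun B hB => by
    rw [sigmaSq_margCompl hφ (Finset.mem_powerset.1 hB), mul_sub]]
  rw [Finset.sum_sub_distrib, ← Finset.sum_mul, h0, zero_mul, sub_zero]
  rfl

theorem IsIIDSample.variance_prodEst (h : IsIIDSample μ P X) (hN : 0 < N)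
    (hφ : MemLp φ 2 (Measure.pi μ)) :
    Var[fun ω => prodEst φ (fun i => X i ω); P] =
      ∑ A : Finset (Fin K) with A.Nonempty, 1 / (N : ℝ) ^ A.card *
        ∑ B ∈ A.powerset, (-1 : ℝ) ^ (A.card - B.card) * sigmaSq μ A B (margCompl μ A φ) := by
  have hi := hφ.integrable one_le_two
  rw [variance_eq_sub (h.memLp_prodEst hφ), h.integral_prodEst hN hi]
  have h2 := h.integral_prodEst_sq hN hφ
  simp only [Pi.pow_apply]
  -- The only other set is ∅, whose term cancels the squared mean.
  rw [h2, ← Finset.sum_filter_add_sum_filter_not _ fun A : Finset (Fin K) => A.Nonempty]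
  have h3 : (Finset.univ.filter fun A : Finset (Fin K) => ¬ A.Nonempty) = {∅} := by
    ext A; simp [Finset.not_nonempty_iff_eq_empty]
  rw [h3, Finset.sum_singleton]
  have h4 : moebius (margSq μ φ) ∅ = (∫ z, φ z ∂(Measure.pi μ)) ^ 2 := by
    simp [moebius, margSq_empty hi]
  rw [h4]
  simp only [Finset.card_empty, pow_zero, div_one, one_mul, add_sub_cancel_right]
  refine Finset.sum_congr rfl fun A hA => ?_
  rw [moebius_margSq_eq_sigmaSq hφ (Finset.mem_filter.1 hA).2]

end ProductForm

/-! ### The Hájek decomposition -/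

namespace ProductForm

section Sum

/-- Each value of `n k` is taken equally often; the factor `N` on the left avoids the exponent |ι| -
1. -/
theorem sum_eval {ι : Type*} [Fintype ι] [DecidableEq ι] {N : ℕ} (k : ι) (f : Fin N → ℝ) :
    (N : ℝ) * ∑ n : ι → Fin N, f (n k) = (N : ℝ) ^ Fintype.card ι * ∑ i, f i := by
  have hc := Fintype.card_congr (Equiv.funSplitAt k (Fin N))
  rw [Fintype.card_prod, Fintype.card_fun, Fintype.card_fin] at hc
  have hc' := congrArg (Nat.cast : ℕ → ℝ) hc
  push_cast at hc'
  rw [← (Equiv.funSplitAt k (Fin N)).symm.sum_comp, Fintype.sum_prod_type, hc', mul_assoc]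
  congr 1
  simp [Finset.mul_sum]

variable {K N : ℕ} {S : Fin K → Type*} (φ ψ : (∀ k, S k) → ℝ) (x : Fin N → ∀ k, S k)

theorem prodEst_add : prodEst (fun y => φ y + ψ y) x = prodEst φ x + prodEst ψ x := by
  simp [prodEst, Finset.sum_add_distrib, mul_add]

theorem prodEst_sum {ι : Type*} (s : Finset ι) (φ : ι → (∀ k, S k) → ℝ) :
    prodEst (fun y => ∑ i ∈ s, φ i y) x = ∑ i ∈ s, prodEst (φ i) x := by
  simp only [prodEst]
  rw [Finset.sum_comm, Finset.mul_sum]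

theorem prodEst_const (hN : 0 < N) (c : ℝ) : prodEst (fun _ : ∀ k, S k => c) x = c := by
  have : (N : ℝ) ≠ 0 := by positivity
  simp [prodEst]
  field_simp

theorem prodEst_of_coord (hN : 0 < N) (k : Fin K)
    (h : ∀ n : Fin K → Fin N, φ (fun j => x (n j) j) = φ (x (n k))) :
    prodEst φ x = (N : ℝ)⁻¹ * ∑ i, φ (x i) := by
  have hN' : (N : ℝ) ≠ 0 := by positivity
  have := sum_eval (ι := Fin K) k fun i => φ (x i)
  simp only [prodEst, h]
  rw [Fintype.card_fin] at this
  field_simp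
  rw [mul_comm, this]

end Sum

variable {K : ℕ} {S : Fin K → Type*} [∀ k, MeasurableSpace (S k)]

/-- The centred average of `φ` given its `k`-th argument. -/
noncomputable def coordProj (μ : ∀ k, Measure (S k)) (φ : (∀ k, S k) → ℝ) (k : Fin K) :
    (∀ k, S k) → ℝ :=
  fun x => margCompl μ {k} φ (fun j => x j) - ∫ z, φ z ∂(Measure.pi μ)

/-- The Hájek projection of `φ - μ(φ)`. -/
noncomputable def hajek (μ : ∀ k, Measure (S k)) (φ : (∀ k, S k) → ℝ) : (∀ k, S k) → ℝ :=
  fun x => ∑ k, coordProj μ φ k x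

/-- The part of `φ - μ(φ)` that is orthogonal to all functions of one coordinate. -/
noncomputable def hajekRem (μ : ∀ k, Measure (S k)) (φ : (∀ k, S k) → ℝ) : (∀ k, S k) → ℝ :=
  fun x => φ x - ∫ z, φ z ∂(Measure.pi μ) - hajek μ φ x

theorem coordProj_congr {μ : ∀ k, Measure (S k)} {φ : (∀ k, S k) → ℝ} {k : Fin K}
    {x y : ∀ k, S k} (h : x k = y k) : coordProj μ φ k x = coordProj μ φ k y := by
  unfold coordProj
  congr 2
  funext ⟨j, hj⟩
  obtain rfl := Finset.mem_singleton.1 hj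
  exact h

theorem prodEst_eq_hajek {N : ℕ} (hN : 0 < N) (μ : ∀ k, Measure (S k)) (φ : (∀ k, S k) → ℝ)
    (x : Fin N → ∀ k, S k) :
    prodEst φ x = ∫ z, φ z ∂(Measure.pi μ) + (N : ℝ)⁻¹ * ∑ i, hajek μ φ (x i) +
      prodEst (hajekRem μ φ) x := by
  have h1 : φ = fun y => ((fun _ => ∫ z, φ z ∂(Measure.pi μ)) y + hajek μ φ y) +
      hajekRem μ φ y := by
    funext y; simp only [hajekRem]; ring
  have h2 : prodEst (hajek μ φ) x = (N : ℝ)⁻¹ * ∑ i, hajek μ φ (x i) := by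
    have h : hajek μ φ = fun y => ∑ k, coordProj μ φ k y := rfl
    rw [h, prodEst_sum, Finset.sum_congr rfl fun k _ =>
      prodEst_of_coord (coordProj μ φ k) x hN k fun n => coordProj_congr rfl]
    rw [← Finset.mul_sum, Finset.sum_comm]
  conv_lhs => rw [h1]
  rw [prodEst_add, prodEst_add, prodEst_const x hN, h2]

variable {μ : ∀ k, Measure (S k)} [∀ k, IsProbabilityMeasure (μ k)] {φ : (∀ k, S k) → ℝ}

theorem memLp_coordProj (hφ : MemLp φ 2 (Measure.pi μ)) (k : Fin K) :
    MemLp (coordProj μ φ k) 2 (Measure.pi μ) :=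
  ((memLp_margCompl hφ {k}).comp_measurePreserving (measurePreserving_restrict μ {k})).sub
    (memLp_const _)

theorem memLp_hajek (hφ : MemLp φ 2 (Measure.pi μ)) : MemLp (hajek μ φ) 2 (Measure.pi μ) :=
  memLp_finsetSum _ fun k _ => memLp_coordProj hφ k

theorem memLp_hajekRem (hφ : MemLp φ 2 (Measure.pi μ)) :
    MemLp (hajekRem μ φ) 2 (Measure.pi μ) :=
  (hφ.sub (memLp_const _)).sub (memLp_hajek hφ)

theorem memLp_margCompl_sub (hφ : MemLp φ 2 (Measure.pi μ)) (A : Finset (Fin K)) :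
    MemLp (fun z => margCompl μ A φ z - ∫ z, φ z ∂(Measure.pi μ)) 2 (prodOn μ A) :=
  (memLp_margCompl hφ A).sub (memLp_const _)

/-- A general `r` is needed because the coordinates in `A` are read off from S, from a partial
product and from a single factor. -/
theorem integral_margCompl_sub (hφ : MemLp φ 2 (Measure.pi μ)) {A : Finset (Fin K)}
    {α : Type*} [MeasurableSpace α] {ν : Measure α} {r : α → ∀ k : A, S k}
    (hr : MeasurePreserving r ν (prodOn μ A)) :
    ∫ y, (margCompl μ A φ (r y) - ∫ z, φ z ∂(Measure.pi μ)) ∂ν = 0 := by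
  refine (integral_comp_of_measurePreserving hr
    (memLp_margCompl_sub hφ A).aestronglyMeasurable).trans ?_
  rw [integral_sub ((memLp_margCompl hφ A).integrable one_le_two) (integrable_const _),
    integral_margCompl (hφ.integrable one_le_two)]
  simp

theorem integral_coordProj (hφ : MemLp φ 2 (Measure.pi μ)) (k : Fin K) :
    ∫ x, coordProj μ φ k x ∂(Measure.pi μ) = 0 :=
  integral_margCompl_sub hφ (measurePreserving_restrict μ {k})

theorem integral_hajek (hφ : MemLp φ 2 (Measure.pi μ)) :
    ∫ x, hajek μ φ x ∂(Measure.pi μ) = 0 := by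
  unfold hajek
  rw [integral_finsetSum _ fun k _ => (memLp_coordProj hφ k).integrable one_le_two]
  simp [integral_coordProj hφ]

theorem integral_hajekRem (hφ : MemLp φ 2 (Measure.pi μ)) :
    ∫ x, hajekRem μ φ x ∂(Measure.pi μ) = 0 := by
  have hi := hφ.integrable one_le_two
  unfold hajekRem
  have hc : Integrable (fun x => φ x - ∫ z, φ z ∂(Measure.pi μ)) (Measure.pi μ) :=
    hi.sub (integrable_const _)
  rw [integral_sub hc ((memLp_hajek hφ).integrable one_le_two), integral_sub hi (integrable_const _), integral_hajek hφ]
  simp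

theorem margCompl_coordProj_self (k : Fin K) (x : ∀ j : ({k} : Finset (Fin K)), S j) :
    margCompl μ {k} (coordProj μ φ k) x = margCompl μ {k} φ x - ∫ z, φ z ∂(Measure.pi μ) := by
  have h : ∀ y, coordProj μ φ k (glueCompl {k} x y) =
      margCompl μ {k} φ x - ∫ z, φ z ∂(Measure.pi μ) := by
    intro y
    unfold coordProj
    congr 2
    funext j
    simp only [glueCompl, j.2, dite_true]
  rw [margCompl]
  simp [h]

theorem margCompl_coordProj_of_notMem (hφ : MemLp φ 2 (Measure.pi μ)) {k : Fin K}
    {T : Finset (Fin K)} (hk : k ∉ T) (x : ∀ j : T, S j) :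
    margCompl μ T (coordProj μ φ k) x = 0 := by
  have hmem : ∀ j : ({k} : Finset (Fin K)), (j : Fin K) ∈ Tᶜ := fun j => by
    rw [Finset.mem_singleton.1 j.2]; exact Finset.mem_compl.2 hk
  have hr : MeasurePreserving
      (fun (y : ∀ j : (Tᶜ : Finset (Fin K)), S j) (j : ({k} : Finset (Fin K))) => y ⟨j, hmem j⟩)
      (prodOn μ Tᶜ) (prodOn μ {k}) :=
    measurePreserving_pi_precomp (fun j : (Tᶜ : Finset (Fin K)) => μ j)
      (a := fun j : ({k} : Finset (Fin K)) => ⟨j, hmem j⟩)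
      fun i j hij => Subtype.ext (by simpa only [Subtype.mk.injEq] using hij)
  have h : ∀ y, coordProj μ φ k (glueCompl T x y) =
      margCompl μ {k} φ (fun j => y ⟨j, hmem j⟩) - ∫ z, φ z ∂(Measure.pi μ) := by
    intro y
    unfold coordProj
    congr 2
    funext j
    simp only [glueCompl, Finset.mem_compl.1 (hmem j), dite_false]
  rw [margCompl]
  simp only [h]
  exact integral_margCompl_sub hφ hr

theorem margCompl_hajekRem (hφ : MemLp φ 2 (Measure.pi μ)) (T : Finset (Fin K)) :
    ∀ᵐ x ∂(prodOn μ T), margCompl μ T (hajekRem μ φ) x =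
      margCompl μ T φ x - ∫ z, φ z ∂(Measure.pi μ) - ∑ k, margCompl μ T (coordProj μ φ k) x := by
  filter_upwards [ae_integrable_glueCompl (hφ.integrable one_le_two) T,
    eventually_countable_forall.2 fun k =>
      ae_integrable_glueCompl ((memLp_coordProj hφ k).integrable one_le_two) T] with x h1 h2
  simp only [margCompl, hajekRem, hajek]
  have h3 : Integrable (fun y => φ (glueCompl T x y) - ∫ z, φ z ∂(Measure.pi μ)) (prodOn μ Tᶜ) :=
    h1.sub (integrable_const _)
  rw [integral_sub h3 (integrable_finsetSum _ fun k _ => h2 k),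
    integral_sub h1 (integrable_const _), integral_finsetSum _ fun k _ => h2 k]
  simp

/-- For T = ∅ the remainder is centred. For T = {k} the projections on other coordinates average to
zero, and the one on `k` cancels the centred average of φ. -/
theorem margSq_hajekRem (hφ : MemLp φ 2 (Measure.pi μ)) {T : Finset (Fin K)} (hT : T.card ≤ 1) :
    margSq μ (hajekRem μ φ) T = 0 := by
  obtain h | h := Nat.le_one_iff_eq_zero_or_eq_one.1 hT
  · rw [Finset.card_eq_zero] at h
    subst h
    rw [margSq_empty ((memLp_hajekRem hφ).integrable one_le_two), integral_hajekRem hφ]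
    simp
  · obtain ⟨k, rfl⟩ := Finset.card_eq_one.1 h
    have h0 : ∀ᵐ x ∂(prodOn μ {k}), margCompl μ {k} (hajekRem μ φ) x ^ 2 = 0 := by
      filter_upwards [margCompl_hajekRem hφ {k}] with x hx
      rw [hx, Finset.sum_eq_single k, margCompl_coordProj_self]
      · simp
      · exact fun j _ hj => margCompl_coordProj_of_notMem hφ (by simpa using hj) x
      · simp
    rw [margSq, integral_congr_ae h0]
    simp

theorem moebius_hajekRem (hφ : MemLp φ 2 (Measure.pi μ)) {A : Finset (Fin K)} (hA : A.card ≤ 1) :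
    moebius (margSq μ (hajekRem μ φ)) A = 0 :=
  Finset.sum_eq_zero fun B hB => by
    rw [margSq_hajekRem hφ ((Finset.card_le_card (Finset.mem_powerset.1 hB)).trans hA), mul_zero]

variable {Ω : Type*} [MeasurableSpace Ω] {P : Measure Ω}

/-- Only sets with |A| ≥ 2 contribute, and for them N^{-|A|} ≤ N⁻². -/
theorem integral_prodEst_hajekRem_sq_le [IsProbabilityMeasure P] (hφ : MemLp φ 2 (Measure.pi μ))
    {N : ℕ} (hN : 0 < N) {X : Fin N → Ω → ∀ k, S k} (h : IsIIDSample μ P X) :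
    ∫ ω, prodEst (hajekRem μ φ) (fun i => X i ω) ^ 2 ∂P ≤
      (∑ A : Finset (Fin K), |moebius (margSq μ (hajekRem μ φ)) A|) * (1 / (N : ℝ) ^ 2) := by
  rw [h.integral_prodEst_sq hN (memLp_hajekRem hφ), Finset.sum_mul]
  refine Finset.sum_le_sum fun A _ => ?_
  obtain hA | hA := le_or_gt A.card 1
  · simp [moebius_hajekRem hφ hA]
  · have h1 : (1 : ℝ) ≤ N := by exact_mod_cast hN
    rw [mul_comm]
    refine mul_le_mul (le_abs_self _) ?_ (by positivity) (abs_nonneg _)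
    gcongr
    exact hA

/-- The summands are functions of distinct, hence independent, coordinates, so variances add. The
equivalence `e` identifies S_k with S_{{k}}. -/
theorem variance_hajek (hφ : MemLp φ 2 (Measure.pi μ)) :
    Var[hajek μ φ; Measure.pi μ] = asympVar μ φ := by
  let e : ∀ k, S k ≃ᵐ (∀ j : ({k} : Finset (Fin K)), S j) := fun k =>
    (MeasurableEquiv.piUnique fun j : ({k} : Finset (Fin K)) => S j).symm
  have he : ∀ k, MeasurePreserving (e k) (μ k) (prodOn μ {k}) := fun k =>
    (measurePreserving_piUnique fun j : ({k} : Finset (Fin K)) => μ j).symm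
  have hx : ∀ (x : ∀ k, S k) k, (fun j : ({k} : Finset (Fin K)) => x j) = e k (x k) := fun x k =>
    ((MeasurableEquiv.symm_apply_eq _).2 rfl).symm
  let g : ∀ k, S k → ℝ := fun k s => margCompl μ {k} φ (e k s) - ∫ z, φ z ∂(Measure.pi μ)
  have hg : ∀ k, MemLp (g k) 2 (μ k) := fun k => (memLp_margCompl_sub hφ {k}).comp_measurePreserving (he k)
  have h1 : hajek μ φ = ∑ k, fun x : ∀ k, S k => g k (x k) := by
    funext x
    simp only [hajek, coordProj, Finset.sum_apply, g, hx]
  rw [h1, variance_sum_pi hg, asympVar]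
  refine Finset.sum_congr rfl fun k _ => ?_
  have h0 : ∫ s, g k s ∂(μ k) = 0 := integral_margCompl_sub hφ (he k)
  rw [variance_of_integral_eq_zero (hg k).aemeasurable h0]
  exact integral_comp_of_measurePreserving (he k) (memLp_margCompl_sub hφ {k}).integrable_sq.aestronglyMeasurable

end ProductForm

/-! ### Limit theorems -/

namespace ProductForm

variable {K : ℕ} {S : Fin K → Type*} [∀ k, MeasurableSpace (S k)]
  {μ : ∀ k, Measure (S k)} {φ : (∀ k, S k) → ℝ}
  {Ω : Type*} [MeasurableSpace Ω] {P : Measure Ω} {X : ℕ → Ω → ∀ k, S k}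

theorem IsIIDSample.truncate (h : IsIIDSample μ P X) (N : ℕ) :
    IsIIDSample μ P (fun i : Fin N => X i) :=
  ⟨h.indep.precomp Fin.val_injective, fun i => h.law i⟩

section Comp

variable {f : (∀ k, S k) → ℝ}

theorem IsIIDSample.iIndepFun_comp (h : IsIIDSample μ P X)
    (hf : AEMeasurable f (Measure.pi μ)) : iIndepFun (fun i => f ∘ X i) P :=
  h.indep.comp₀ (fun _ => f) (fun i => (h.law i).aemeasurable)
    fun i => by rw [(h.law i).map_eq]; exact hf

theorem IsIIDSample.identDistrib_comp (h : IsIIDSample μ P X)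
    (hf : AEMeasurable f (Measure.pi μ)) (i : ℕ) : IdentDistrib (f ∘ X i) (f ∘ X 0) P P := by
  have h0 : IdentDistrib (X i) (X 0) P P :=
    ⟨(h.law i).aemeasurable, (h.law 0).aemeasurable, by rw [(h.law i).map_eq, (h.law 0).map_eq]⟩
  exact h0.comp_of_aemeasurable (by rw [(h.law i).map_eq]; exact hf)

theorem IsIIDSample.memLp_comp (h : IsIIDSample μ P X) {p : ENNReal}
    (hf : MemLp f p (Measure.pi μ)) (i : ℕ) : MemLp (f ∘ X i) p P := by
  rw [← (h.law i).map_eq] at hf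
  exact hf.comp_of_map (h.law i).aemeasurable

theorem IsIIDSample.variance_comp (h : IsIIDSample μ P X)
    (hf : AEMeasurable f (Measure.pi μ)) (i : ℕ) : Var[f ∘ X i; P] = Var[f; Measure.pi μ] := by
  rw [← variance_map (by rw [(h.law i).map_eq]; exact hf) (h.law i).aemeasurable, (h.law i).map_eq]

end Comp

theorem eLpNorm_sq_one {f : Ω → ℝ} (hf : MemLp f 2 P) :
    eLpNorm (fun ω => f ω ^ 2) 1 P = ENNReal.ofReal (∫ ω, f ω ^ 2 ∂P) := by
  rw [eLpNorm_one_eq_lintegral_enorm,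
    ofReal_integral_eq_lintegral_ofReal hf.integrable_sq (.of_forall fun ω => sq_nonneg _)]
  exact lintegral_congr fun ω => Real.enorm_of_nonneg (sq_nonneg _)

variable [∀ k, IsProbabilityMeasure (μ k)]

theorem IsIIDSample.integral_hajek_comp (h : IsIIDSample μ P X) (hφ : MemLp φ 2 (Measure.pi μ))
    (i : ℕ) : ∫ ω, (hajek μ φ ∘ X i) ω ∂P = 0 :=
  ((h.law i).integral_comp (memLp_hajek hφ).aestronglyMeasurable).trans (integral_hajek hφ)

variable [IsProbabilityMeasure P]

/-- The second moments are summable, so the squares are almost surely summable and tend to zero. The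
shift to `N + 1` skips N = 0, where the bound is not available. -/
theorem ae_tendsto_prodEst_hajekRem (hφ : MemLp φ 2 (Measure.pi μ)) (h : IsIIDSample μ P X) :
    ∀ᵐ ω ∂P, Tendsto (fun N : ℕ => prodEst (hajekRem μ φ) (fun i : Fin N => X i ω)) atTop
      (𝓝 0) := by
  set C := ∑ A : Finset (Fin K), |moebius (margSq μ (hajekRem μ φ)) A|
  have hL : ∀ N : ℕ, MemLp (fun ω => prodEst (hajekRem μ φ) (fun i : Fin (N + 1) => X i ω)) 2 P :=
    fun N => (h.truncate (N + 1)).memLp_prodEst (memLp_hajekRem hφ)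
  have hs : Summable fun N : ℕ => C * (1 / ((N + 1 : ℕ) : ℝ) ^ 2) :=
    ((summable_nat_add_iff 1).2 (Real.summable_one_div_nat_pow.2 one_lt_two)).mul_left C
  have hsum : ∑' N : ℕ, eLpNorm
      (fun ω => prodEst (hajekRem μ φ) (fun i : Fin (N + 1) => X i ω) ^ 2) 1 P ≠ ⊤ := by
    refine ne_top_of_le_ne_top hs.tsum_ofReal_ne_top (ENNReal.tsum_le_tsum fun N => ?_)
    rw [eLpNorm_sq_one (hL N)]
    exact ENNReal.ofReal_le_ofReal
      (integral_prodEst_hajekRem_sq_le hφ N.succ_pos (h.truncate (N + 1)))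
  filter_upwards [summable_norm_of_tsum_eLpNorm_ne_top le_rfl
    (fun N => (hL N).aestronglyMeasurable.pow 2) hsum] with ω hω
  refine (tendsto_add_atTop_iff_nat 1).1 ?_
  have h0 := hω.tendsto_atTop_zero
  simp only [Pi.pow_apply, norm_pow] at h0
  have h1 := h0.sqrt
  simp only [Real.sqrt_sq (norm_nonneg _), Real.sqrt_zero] at h1
  exact tendsto_zero_iff_norm_tendsto_zero.2 h1

/-- The second moment is at most C/N, so there is even convergence in L². -/
theorem tendstoInMeasure_sqrt_mul_prodEst_hajekRem (hφ : MemLp φ 2 (Measure.pi μ))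
    (h : IsIIDSample μ P X) :
    TendstoInMeasure P (fun (N : ℕ) ω =>
      √(N : ℝ) * prodEst (hajekRem μ φ) (fun i : Fin N => X i ω)) atTop (fun _ => 0) := by
  set C := ∑ A : Finset (Fin K), |moebius (margSq μ (hajekRem μ φ)) A|
  have hL : ∀ N : ℕ, MemLp (fun ω => √(N : ℝ) *
      prodEst (hajekRem μ φ) (fun i : Fin N => X i ω)) 2 P :=
    fun N => ((h.truncate N).memLp_prodEst (memLp_hajekRem hφ)).const_mul _
  refine tendstoInMeasure_of_tendsto_eLpNorm two_ne_zero (fun N => (hL N).aestronglyMeasurable)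
    aestronglyMeasurable_const ?_
  have hb : Tendsto (fun N : ℕ => ENNReal.ofReal (√(C * (1 / (N : ℝ))))) atTop (𝓝 0) := by
    rw [← ENNReal.ofReal_zero, ← Real.sqrt_zero, ← mul_zero C]
    exact ENNReal.tendsto_ofReal ((tendsto_one_div_atTop_nhds_zero_nat.const_mul C).sqrt)
  refine tendsto_of_tendsto_of_tendsto_of_le_of_le' tendsto_const_nhds hb
    (.of_forall fun _ => zero_le) ?_
  filter_upwards [eventually_gt_atTop 0] with N hN
  have hN' : (N : ℝ) ≠ 0 := by positivity
  have e : ((fun ω => √(N : ℝ) * prodEst (hajekRem μ φ) (fun i : Fin N => X i ω)) - fun _ => 0) =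
      fun ω => √(N : ℝ) * prodEst (hajekRem μ φ) (fun i : Fin N => X i ω) := by
    funext ω; simp
  rw [e, (hL N).eLpNorm_eq_integral_rpow_norm two_ne_zero ENNReal.ofNat_ne_top]
  refine ENNReal.ofReal_le_ofReal ?_
  simp only [ENNReal.toReal_ofNat, Real.rpow_two, Real.norm_eq_abs, sq_abs, mul_pow,
    Real.sq_sqrt (Nat.cast_nonneg N)]
  rw [integral_const_mul, ← one_div, ← Real.sqrt_eq_rpow]
  refine Real.sqrt_le_sqrt ?_
  calc (N : ℝ) * ∫ ω, prodEst (hajekRem μ φ) (fun i : Fin N => X i ω) ^ 2 ∂P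
      ≤ N * (C * (1 / (N : ℝ) ^ 2)) := by
        gcongr
        exact integral_prodEst_hajekRem_sq_le hφ hN (h.truncate N)
    _ = C * (1 / (N : ℝ)) := by field_simp

theorem ae_tendsto_prodEst (hφ : MemLp φ 2 (Measure.pi μ)) (h : IsIIDSample μ P X) :
    ∀ᵐ ω ∂P, Tendsto (fun N : ℕ => prodEst φ (fun i : Fin N => X i ω)) atTop
      (𝓝 (∫ x, φ x ∂(Measure.pi μ))) := by
  have hm := memLp_hajek hφ
  have hsl := strong_law_ae_real (fun i => hajek μ φ ∘ X i)
    ((h.memLp_comp hm 0).integrable one_le_two)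
    (fun i j hij => (h.iIndepFun_comp hm.aemeasurable).indepFun hij)
    (h.identDistrib_comp hm.aemeasurable)
  filter_upwards [hsl, ae_tendsto_prodEst_hajekRem hφ h] with ω h1 h2
  rw [h.integral_hajek_comp hφ 0] at h1
  have h3 := (h1.const_add (∫ x, φ x ∂(Measure.pi μ))).add h2
  rw [add_zero, add_zero] at h3
  refine h3.congr' ?_
  filter_upwards [eventually_gt_atTop 0] with N hN
  rw [prodEst_eq_hajek hN μ φ, Fin.sum_univ_eq_sum_range (fun i => hajek μ φ (X i ω)),
    div_eq_inv_mul]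
  rfl

theorem tendstoInDistribution_prodEst (hφ : MemLp φ 2 (Measure.pi μ)) (h : IsIIDSample μ P X) :
    TendstoInDistribution
      (fun (N : ℕ) ω => √(N : ℝ) *
        (prodEst φ (fun i : Fin N => X i ω) - ∫ x, φ x ∂(Measure.pi μ)))
      atTop (id : ℝ → ℝ) (fun _ => P) (gaussianReal 0 (asympVar μ φ).toNNReal) := by
  have hm := memLp_hajek hφ
  have hY : HasLaw (id : ℝ → ℝ) (gaussianReal 0 Var[hajek μ φ ∘ X 0; P].toNNReal)
      (gaussianReal 0 (asympVar μ φ).toNNReal) := by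
    rw [h.variance_comp hm.aemeasurable, variance_hajek hφ]
    exact HasLaw.id
  have hclt := tendstoInDistribution_inv_sqrt_mul_sum_sub (X := fun i => hajek μ φ ∘ X i) hY
    (h.memLp_comp hm 0) (h.iIndepFun_comp hm.aemeasurable) (h.identDistrib_comp hm.aemeasurable)
  -- Slutsky: the scaled remainder does not change the limit law.
  have hadd := hclt.add_of_tendstoInMeasure_const
    (tendstoInMeasure_sqrt_mul_prodEst_hajekRem hφ h) fun N =>
      (((h.truncate N).memLp_prodEst (memLp_hajekRem hφ)).const_mul _).aemeasurable
  refine hadd.congr (fun N => .of_forall fun ω => ?_) (.of_forall fun ω => add_zero _)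
  simp only [Pi.add_apply]
  rw [h.integral_hajek_comp hφ 0]
  simp only [Function.comp_apply]
  obtain rfl | hN := N.eq_zero_or_pos
  · simp
  · rw [prodEst_eq_hajek hN μ φ, Fin.sum_univ_eq_sum_range (fun i => hajek μ φ (X i ω))]
    have hs : √(N : ℝ) * (N : ℝ)⁻¹ = (√(N : ℝ))⁻¹ := by
      rw [← div_eq_mul_inv, Real.sqrt_div_self]
    rw [← hs]
    ring

end ProductForm

theorem theorem1 {K : ℕ} {S : Fin K → Type*} [∀ k, MeasurableSpace (S k)]
    (μ : ∀ k, Measure (S k)) [∀ k, IsProbabilityMeasure (μ k)]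
    {Ω : Type*} [MeasurableSpace Ω] (P : Measure Ω) [IsProbabilityMeasure P]
    (φ : (∀ k, S k) → ℝ) :
    -- unbiasedness
    (Integrable φ (Measure.pi μ) →
      ∀ N : ℕ, 0 < N → ∀ X : Fin N → Ω → ∀ k, S k, ProductForm.IsIIDSample μ P X →
        Integrable (fun ω => ProductForm.prodEst φ (fun i => X i ω)) P ∧
        ∫ ω, ProductForm.prodEst φ (fun i => X i ω) ∂P = ∫ x, φ x ∂(Measure.pi μ)) ∧
    (MemLp φ 2 (Measure.pi μ) →
      -- the partial averages are well defined almost everywhere and square integrable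
      (∀ A : Finset (Fin K),
        (∀ᵐ x ∂(ProductForm.prodOn μ A),
          Integrable (fun y => φ (ProductForm.glueCompl A x y)) (ProductForm.prodOn μ Aᶜ)) ∧
        MemLp (ProductForm.margCompl μ A φ) 2 (ProductForm.prodOn μ A)) ∧
      -- finite-sample variance
      (∀ N : ℕ, 0 < N → ∀ X : Fin N → Ω → ∀ k, S k, ProductForm.IsIIDSample μ P X →
        MemLp (fun ω => ProductForm.prodEst φ (fun i => X i ω)) 2 P ∧
        Var[fun ω => ProductForm.prodEst φ (fun i => X i ω); P] =
          ∑ A : Finset (Fin K) with A.Nonempty, 1 / (N : ℝ) ^ A.card *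
            ∑ B ∈ A.powerset, (-1 : ℝ) ^ (A.card - B.card) *
              ProductForm.sigmaSq μ A B (ProductForm.margCompl μ A φ)) ∧
      -- strong consistency and asymptotic normality
      (∀ X : ℕ → Ω → ∀ k, S k, ProductForm.IsIIDSample μ P X →
        (∀ᵐ ω ∂P, Tendsto (fun N : ℕ => ProductForm.prodEst φ (fun i : Fin N => X i ω)) atTop
          (𝓝 (∫ x, φ x ∂(Measure.pi μ)))) ∧
        TendstoInDistribution
          (fun (N : ℕ) ω => √(N : ℝ) *
            (ProductForm.prodEst φ (fun i : Fin N => X i ω) - ∫ x, φ x ∂(Measure.pi μ)))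
          atTop (id : ℝ → ℝ) (fun _ => P)
          (gaussianReal 0 (ProductForm.asympVar μ φ).toNNReal))) := by
  refine ⟨fun hφ N hN X hX => ⟨?_, hX.integral_prodEst hN hφ⟩, fun hφ => ⟨fun A =>
    ⟨ProductForm.ae_integrable_glueCompl (hφ.integrable one_le_two) A,
      ProductForm.memLp_margCompl hφ A⟩, fun N hN X hX =>
    ⟨hX.memLp_prodEst hφ, hX.variance_prodEst hN hφ⟩, fun X hX =>
    ⟨ProductForm.ae_tendsto_prodEst hφ hX, ProductForm.tendstoInDistribution_prodEst hφ hX⟩⟩⟩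
  exact memLp_one_iff_integrable.1 (hX.memLp_prodEst (memLp_one_iff_integrable.2 hφ))
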